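/- Let $(a(n))_{n\ge 0}$ be a sequence of real numbers that satisfies a linear recurrence \[ a(n+d) = s_1 a(n+d-1) + \dots + s_{d-1}a(n+1) + s_d a(n), \qquad n\ge 0, \] with constant coefficients $s_1,\dots,s_d\in\mathbb{R}$, and suppose that $a(n)\neq 0$ for infinitely many $n$ (if $s_d\neq 0$, this just says that the sequence is not identically zero). Let $\alpha_1,\dots,\alpha_s$ be the distinct nonzero complex roots of the characteristic polynomial $z^d - s_1 z^{d-1}-\dots-s_{d-1}z-s_d$, and write, for all sufficiently large $n$ (for all $n\ge 0$ if $s_d\ne 0$), \[ a(n) = C_1(n)\alpha_1^n + \dots + C_s(n)\alpha_s^n \] with the uniquely determined polynomials $C_1,\dots,C_s\in\mathbb{C}[n]$. The characteristic roots of $(a(n))$ are the $\alpha_k$ with $C_k\neq 0$; the dominating characteristic roots of $(a(n))$ are the characteristic roots of $(a(n))$ of maximal modulus. If $(a(n))$ has at most four (distinct) dominating characteristic roots, and none of them is a positive real number, then $a(n)>0$ for infinitely many $n$ and $a(n)<0$ for infinitely many $n$. -/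

import Mathlib

open Polynomial Filter

noncomputable section

namespace RecurrenceSequence

/-- The set of distinct nonzero complex roots of the characteristic polynomial of `E`. -/
def nonzeroRoots (E : LinearRecurrence ℝ) : Finset ℂ :=
  (E.charPoly.aroots ℂ).toFinset.erase 0

/-- `C` gives the coefficients of a representation of `a` as a generalized power sum
`a n = ∑ α, C_α(n) α ^ n` over the roots `α` of the characteristic polynomial of `E`, with
polynomials `C_α`. A root `0` (present only if the last coefficient of the recurrence is `0`)
affects only finitely many terms of a solution; therefore it is left out, and the identity is
required for all large `n`. Without a root `0`, the identity for all large `n` and the identity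
for all `n` are equivalent for solutions of `E`. -/
def IsPowerSumRepr (E : LinearRecurrence ℝ) (a : ℕ → ℝ) (C : ℂ → ℂ[X]) : Prop :=
  ∀ᶠ n : ℕ in atTop, (a n : ℂ) = ∑ α ∈ nonzeroRoots E, (C α).eval (n : ℂ) * α ^ n

/-- The (nonzero) characteristic roots of the solution `a` of `E`: the roots that occur with a
nonzero coefficient in the representation of `a` as a generalized power sum. -/
def charRoots (E : LinearRecurrence ℝ) (a : ℕ → ℝ) : Set ℂ :=
  {α | α ∈ nonzeroRoots E ∧ ∃ C : ℂ → ℂ[X], IsPowerSumRepr E a C ∧ C α ≠ 0}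

/-- The dominating characteristic roots: the characteristic roots of maximal modulus. -/
def dominatingRoots (E : LinearRecurrence ℝ) (a : ℕ → ℝ) : Set ℂ :=
  {α | α ∈ charRoots E a ∧ ∀ β ∈ charRoots E a, ‖β‖ ≤ ‖α‖}

end RecurrenceSequence

end

open Polynomial Filter Topology

namespace RecurrenceSequence

/-! ### Existence of the representation as a generalized power sum -/

/-! By symmetry under `a ↦ -a` it suffices to rule out that `a n ≥ 0` for all large `n`. Factoring
the characteristic polynomial in the shift operator gives `a n = ∑ C_α(n) α ^ n` eventually. Choose
`w` of maximal modulus among the roots with `C_w ≠ 0` and then with `D = deg C_w` maximal.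

The Cesàro means of `a n / (n ^ D * w ^ n)` isolate the leading coefficient of `C_w`, which is
nonzero (`cesaroTendsto_powerSum_div`). Those of `a n / (n ^ D * ‖w‖ ^ n)` isolate the degree `D`
coefficient at `‖w‖`. For `a n ≥ 0` the second sequence is the absolute value of the first, so its
means cannot tend to zero. Hence `‖w‖` is itself a dominating root (`exists_pos_dominating`), which
is excluded. -/

/-- The shift operator on complex sequences. -/
noncomputable def shift : Module.End ℂ (ℕ → ℂ) where
  toFun f n := f (n + 1)
  map_add' _ _ := rfl
  map_smul' _ _ := rfl

theorem shift_pow_apply (f : ℕ → ℂ) (k n : ℕ) : (shift ^ k) f n = f (n + k) := by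
  induction k generalizing f with
  | zero => simp
  | succ k ih =>
    rw [pow_succ, Module.End.mul_apply, ih]
    rfl

/-- A solution of a linear recurrence is annihilated by the characteristic polynomial evaluated
at the shift. -/
theorem aeval_shift_charPoly {E : LinearRecurrence ℝ} {a : ℕ → ℝ} (ha : E.IsSolution a) :
    aeval shift (E.charPoly.map (algebraMap ℝ ℂ)) (fun n => (a n : ℂ)) = 0 := by
  ext n
  have h := congrArg (fun x : ℝ => (x : ℂ)) (ha n)
  push_cast at h
  simp [LinearRecurrence.charPoly, Polynomial.map_sum, aeval_monomial, shift_pow_apply, h]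

/-- Sequences annihilated by a product of powers of distinct linear factors of the shift are sums
of sequences annihilated by the single factors. -/
theorem exists_sum_of_aeval_shift_prod (S : Finset ℂ) (m : ℂ → ℕ) (f : ℕ → ℂ)
    (hf : aeval shift (∏ α ∈ S, (X - C α) ^ m α) f = 0) :
    ∃ g : ℂ → ℕ → ℂ, (∀ α ∈ S, aeval shift ((X - C α) ^ m α) (g α) = 0) ∧
      f = ∑ α ∈ S, g α := by
  classical
  induction S using Finset.induction_on generalizing f with
  | empty => exact ⟨0, by simp, by simpa using hf⟩
  | insert β S hβ ih =>
    rw [Finset.prod_insert hβ] at hf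
    have hcop : IsCoprime ((X - C β) ^ m β) (∏ α ∈ S, (X - C α) ^ m α) := by
      refine IsCoprime.prod_right fun α hα => IsCoprime.pow ?_
      refine pairwise_coprime_X_sub_C Function.injective_id ?_
      rintro rfl
      exact hβ hα
    have hmem : f ∈ LinearMap.ker (aeval shift ((X - C β) ^ m β * ∏ α ∈ S, (X - C α) ^ m α)) := hf
    rw [← sup_ker_aeval_eq_ker_aeval_mul_of_coprime shift hcop, Submodule.mem_sup] at hmem
    obtain ⟨u, hu, v, hv, rfl⟩ := hmem
    obtain ⟨g, hg, rfl⟩ := ih v hv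
    refine ⟨Function.update g β u, fun α hα => ?_, ?_⟩
    · rcases Finset.mem_insert.1 hα with rfl | hα
      · simpa using hu
      · rw [Function.update_of_ne (ne_of_mem_of_not_mem hα hβ)]
        exact hg α hα
    · rw [Finset.sum_insert hβ, Function.update_self]
      congr 1
      refine Finset.sum_congr rfl fun α hα => ?_
      rw [Function.update_of_ne (ne_of_mem_of_not_mem hα hβ)]

theorem eventually_eq_zero_of_aeval_shift_X_pow {k : ℕ} {f : ℕ → ℂ}
    (hf : aeval shift (X ^ k : ℂ[X]) f = 0) : ∀ᶠ n in atTop, f n = 0 := by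
  filter_upwards [eventually_ge_atTop k] with n hn
  have h := congrFun hf (n - k)
  rw [map_pow, aeval_X, shift_pow_apply] at h
  simpa [Nat.sub_add_cancel hn] using h

/-- Sequences annihilated by a power of `shift - α` with `α ≠ 0` are polynomial multiples of
`α ^ n`. -/
theorem exists_polynomial_of_aeval_shift_X_sub_C_pow {α : ℂ} (hα : α ≠ 0) {k : ℕ} {f : ℕ → ℂ}
    (hf : aeval shift ((X - C α) ^ k) f = 0) :
    ∃ P : ℂ[X], ∀ n : ℕ, f n = P.eval (n : ℂ) * α ^ n := by
  set N : Module.End ℂ (ℕ → ℂ) := shift - algebraMap ℂ _ α with hN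
  have hNk : (N ^ k) f = 0 := by simpa [hN] using hf
  have hNj (j : ℕ) (hj : k ≤ j) : (N ^ j) f = 0 := by
    rw [← Nat.sub_add_cancel hj, pow_add, Module.End.mul_apply, hNk, map_zero]
  -- Newton's expansion: `n.choose j` is `descPochhammer ℂ j` at `n` over `j!`, and `N ^ j` kills
  -- `f` for `j ≥ k`.
  refine ⟨∑ j ∈ Finset.range k,
    C ((N ^ j) f 0 * (α ^ j)⁻¹ * ((j.factorial : ℂ))⁻¹) * descPochhammer ℂ j, fun n => ?_⟩
  have hexp : f n = ∑ j ∈ Finset.range (n + 1), (n.choose j : ℂ) * α ^ (n - j) * (N ^ j) f 0 := by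
    have hcomm : Commute N (algebraMap ℂ _ α) := (Algebra.commutes α N).symm
    have hs : shift = N + algebraMap ℂ _ α := by simp [hN]
    have h0 : f n = (shift ^ n) f 0 := by simp [shift_pow_apply]
    rw [h0, hs, hcomm.add_pow]
    simp only [LinearMap.sum_apply, Finset.sum_apply]
    refine Finset.sum_congr rfl fun j _ => ?_
    rw [mul_assoc, Module.End.mul_apply, ← map_pow, ← map_natCast (algebraMap ℂ _), ← map_mul,
      Module.algebraMap_end_apply, map_smul, Pi.smul_apply, smul_eq_mul]
    ring
  -- For `j > n` the subtraction truncates, but the binomial coefficient vanishes.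
  have hterm (j : ℕ) : (n.choose j : ℂ) * α ^ (n - j) * (N ^ j) f 0 =
      (n.choose j : ℂ) * (α ^ n * (α ^ j)⁻¹) * (N ^ j) f 0 := by
    rcases le_or_gt j n with hj | hj
    · rw [pow_sub₀ α hα hj]
    · simp [Nat.choose_eq_zero_of_lt hj]
  have hext : f n = ∑ j ∈ Finset.range k,
      (n.choose j : ℂ) * (α ^ n * (α ^ j)⁻¹) * (N ^ j) f 0 := by
    rw [hexp, Finset.sum_congr rfl fun j _ => hterm j]
    trans ∑ j ∈ Finset.range (max (n + 1) k),
      (n.choose j : ℂ) * (α ^ n * (α ^ j)⁻¹) * (N ^ j) f 0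
    · refine Finset.sum_subset (Finset.range_mono (le_max_left _ _)) fun j _ hj => ?_
      rw [Finset.mem_range, not_lt] at hj
      simp [Nat.choose_eq_zero_of_lt (Nat.lt_of_succ_le hj)]
    · refine (Finset.sum_subset (Finset.range_mono (le_max_right _ _)) fun j _ hj => ?_).symm
      rw [Finset.mem_range, not_lt] at hj
      simp [hNj j hj]
  rw [hext, eval_finsetSum, Finset.sum_mul]
  refine Finset.sum_congr rfl fun j _ => ?_
  rw [Nat.cast_choose_eq_descPochhammer_div, eval_mul, eval_C]
  ring

theorem exists_isPowerSumRepr {E : LinearRecurrence ℝ} {a : ℕ → ℝ} (ha : E.IsSolution a) :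
    ∃ C : ℂ → ℂ[X], IsPowerSumRepr E a C := by
  classical
  set p := E.charPoly.map (algebraMap ℝ ℂ) with hp
  have hmonic : p.Monic := E.charPoly_monic.map _
  have hprod : p = ∏ α ∈ p.roots.toFinset, (X - Polynomial.C α) ^ rootMultiplicity α p := by
    rw [← prod_multiset_root_eq_finset_root]
    exact (IsAlgClosed.splits p).eq_prod_roots_of_monic hmonic
  have hker := aeval_shift_charPoly ha
  rw [← hp, hprod] at hker
  obtain ⟨g, hg, hsum⟩ := exists_sum_of_aeval_shift_prod _ _ _ hker
  have hpoly (α : ℂ) : ∃ P : ℂ[X], α ∈ p.roots.toFinset → α ≠ 0 →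
      ∀ n : ℕ, g α n = P.eval (n : ℂ) * α ^ n := by
    by_cases h : α ∈ p.roots.toFinset ∧ α ≠ 0
    · obtain ⟨P, hP⟩ := exists_polynomial_of_aeval_shift_X_sub_C_pow h.2 (hg α h.1)
      exact ⟨P, fun _ _ => hP⟩
    · exact ⟨0, fun h₁ h₂ => absurd ⟨h₁, h₂⟩ h⟩
  choose P hP using hpoly
  refine ⟨P, ?_⟩
  have hzero : ∀ᶠ n in atTop, 0 ∈ p.roots.toFinset → g 0 n = 0 := by
    by_cases h : (0 : ℂ) ∈ p.roots.toFinset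
    · have h0 := hg 0 h
      rw [map_zero, sub_zero] at h0
      exact (eventually_eq_zero_of_aeval_shift_X_pow h0).mono fun _ hn _ => hn
    · exact Eventually.of_forall fun _ hn => absurd hn h
  have hroots : nonzeroRoots E = p.roots.toFinset.erase 0 := by
    simp [nonzeroRoots, Polynomial.aroots, hp]
  filter_upwards [hzero] with n hn
  have h := congrFun hsum n
  simp only [Finset.sum_apply] at h
  have hsplit : ∑ α ∈ p.roots.toFinset, g α n = ∑ α ∈ p.roots.toFinset.erase 0, g α n := by
    by_cases h0 : (0 : ℂ) ∈ p.roots.toFinset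
    · exact (Finset.sum_erase (f := fun α => g α n) _ (hn h0)).symm
    · rw [Finset.erase_eq_of_notMem h0]
  rw [h, hsplit, hroots]
  refine Finset.sum_congr rfl fun α hα => ?_
  obtain ⟨hα0, hα⟩ := Finset.mem_erase.1 hα
  exact hP α hα hα0 n

/-! ### Cesàro means of generalized power sums -/

/-- The Cesàro means of the sequence `u` converge to `l`. -/
def CesaroTendsto (u : ℕ → ℂ) (l : ℂ) : Prop :=
  Tendsto (fun n : ℕ => (n⁻¹ : ℝ) • ∑ i ∈ Finset.range n, u i) atTop (𝓝 l)

theorem cesaroTendsto_of_tendsto {u : ℕ → ℂ} {l : ℂ} (h : Tendsto u atTop (𝓝 l)) :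
    CesaroTendsto u l :=
  h.cesaro_smul

theorem cesaroTendsto_zero : CesaroTendsto (fun _ => 0) 0 :=
  cesaroTendsto_of_tendsto tendsto_const_nhds

theorem CesaroTendsto.add {u v : ℕ → ℂ} {l m : ℂ} (hu : CesaroTendsto u l)
    (hv : CesaroTendsto v m) : CesaroTendsto (fun n => u n + v n) (l + m) := by
  simpa only [CesaroTendsto, Finset.sum_add_distrib, smul_add] using Tendsto.add hu hv

theorem CesaroTendsto.const_mul {u : ℕ → ℂ} {l : ℂ} (hu : CesaroTendsto u l) (c : ℂ) :
    CesaroTendsto (fun n => c * u n) (c * l) := by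
  simpa only [CesaroTendsto, ← Finset.mul_sum, mul_smul_comm] using Tendsto.const_mul c hu

theorem CesaroTendsto.sum {ι : Type*} (S : Finset ι) {u : ι → ℕ → ℂ} {l : ι → ℂ}
    (h : ∀ i ∈ S, CesaroTendsto (u i) (l i)) :
    CesaroTendsto (fun n => ∑ i ∈ S, u i n) (∑ i ∈ S, l i) := by
  have h' := tendsto_finsetSum S h
  refine h'.congr fun n => ?_
  rw [← Finset.smul_sum, Finset.sum_comm]

theorem CesaroTendsto.unique {u : ℕ → ℂ} {l m : ℂ} (hl : CesaroTendsto u l)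
    (hm : CesaroTendsto u m) : l = m :=
  tendsto_nhds_unique hl hm

theorem CesaroTendsto.congr' {u v : ℕ → ℂ} {l : ℂ} (hu : CesaroTendsto u l)
    (huv : ∀ᶠ n in atTop, u n = v n) : CesaroTendsto v l := by
  have h0 : CesaroTendsto (fun n => v n - u n) 0 := by
    refine cesaroTendsto_of_tendsto (tendsto_const_nhds.congr' ?_)
    filter_upwards [huv] with n hn
    rw [hn, sub_self]
  simpa using hu.add h0

/-- If the Cesàro means of `‖u‖` tend to zero, then so do those of every sequence with the same
absolute values. -/
theorem CesaroTendsto.zero_of_norm_eq {u v : ℕ → ℂ}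
    (hu : CesaroTendsto (fun n => (‖u n‖ : ℂ)) 0) (huv : ∀ n, ‖v n‖ = ‖u n‖) :
    CesaroTendsto v 0 := by
  refine squeeze_zero_norm (fun n => ?_) (tendsto_zero_iff_norm_tendsto_zero.1 hu)
  rw [norm_smul, norm_smul]
  refine mul_le_mul_of_nonneg_left ?_ (norm_nonneg _)
  rw [← Complex.ofReal_sum, Complex.norm_real,
    Real.norm_of_nonneg (Finset.sum_nonneg fun _ _ => norm_nonneg _)]
  simpa only [huv] using norm_sum_le (Finset.range n) v

/-- The geometric partial sums stay bounded by `2 / ‖z - 1‖`. -/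
theorem cesaroTendsto_pow {z : ℂ} (hz : ‖z‖ = 1) (hz1 : z ≠ 1) :
    CesaroTendsto (fun n => z ^ n) 0 := by
  have h : Tendsto (fun n : ℕ => (n⁻¹ : ℝ) * (2 / ‖z - 1‖)) atTop (𝓝 0) := by
    simpa using (tendsto_inv_atTop_nhds_zero_nat (𝕜 := ℝ)).mul_const (2 / ‖z - 1‖)
  refine squeeze_zero_norm (fun n => ?_) h
  rw [norm_smul, Real.norm_of_nonneg (by positivity), geom_sum_eq hz1, norm_div]
  gcongr
  calc ‖z ^ n - 1‖ ≤ ‖z ^ n‖ + ‖(1 : ℂ)‖ := norm_sub_le _ _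
    _ = 2 := by rw [norm_pow, hz]; norm_num

theorem tendsto_eval_div_pow {P : ℂ[X]} {D : ℕ} (hP : P.natDegree ≤ D) :
    Tendsto (fun n : ℕ => P.eval (n : ℂ) / (n : ℂ) ^ D) atTop (𝓝 (P.coeff D)) := by
  have hterm (i : ℕ) (hi : i ∈ Finset.range (D + 1)) :
      Tendsto (fun n : ℕ => P.coeff i * ((n : ℂ)⁻¹) ^ (D - i)) atTop
        (𝓝 (P.coeff i * 0 ^ (D - i))) :=
    ((tendsto_inv_atTop_nhds_zero_nat (𝕜 := ℂ)).pow _).const_mul _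
  have h := tendsto_finsetSum _ hterm
  have hl : ∑ i ∈ Finset.range (D + 1), P.coeff i * (0 : ℂ) ^ (D - i) = P.coeff D := by
    rw [Finset.sum_range_succ, Finset.sum_eq_zero]
    · simp
    · intro i hi
      rw [Finset.mem_range] at hi
      rw [zero_pow (by omega), mul_zero]
  rw [hl] at h
  refine h.congr' ?_
  filter_upwards [eventually_ne_atTop 0] with n hn
  have hn' : (n : ℂ) ≠ 0 := Nat.cast_ne_zero.2 hn
  rw [eval_eq_sum_range' (Nat.lt_succ_of_le hP), Finset.sum_div]
  refine Finset.sum_congr rfl fun i hi => ?_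
  rw [Finset.mem_range, Nat.lt_succ_iff] at hi
  rw [inv_pow, pow_sub₀ _ hn' hi]
  field_simp

theorem tendsto_eval_div_pow_mul_pow (P : ℂ[X]) (D : ℕ) {z : ℂ} (hz : ‖z‖ < 1) :
    Tendsto (fun n : ℕ => P.eval (n : ℂ) / (n : ℂ) ^ D * z ^ n) atTop (𝓝 0) := by
  have h1 : Tendsto (fun n : ℕ => P.eval (n : ℂ) / (n : ℂ) ^ P.natDegree) atTop
      (𝓝 (P.coeff P.natDegree)) := tendsto_eval_div_pow le_rfl
  have h2 : Tendsto (fun n : ℕ => (n : ℂ) ^ P.natDegree / (n : ℂ) ^ D * z ^ n) atTop (𝓝 0) := by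
    refine squeeze_zero_norm (fun n => ?_)
      (tendsto_pow_const_mul_const_pow_of_lt_one P.natDegree (norm_nonneg z) hz)
    rw [norm_mul, norm_div, norm_pow, norm_pow, norm_pow, Complex.norm_natCast]
    gcongr
    rcases Nat.eq_zero_or_pos n with rfl | hn
    · rcases Nat.eq_zero_or_pos D with rfl | hD
      · simp
      · simp [zero_pow hD.ne']
    · exact div_le_self (by positivity) (one_le_pow₀ (by exact_mod_cast hn))
  have h := h1.mul h2
  rw [mul_zero] at h
  refine h.congr' ?_
  filter_upwards [eventually_ne_atTop 0] with n hn
  have hn' : (n : ℂ) ≠ 0 := Nat.cast_ne_zero.2 hn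
  field_simp

/-- Inside the unit disc exponential decay beats any degree, so the degree is bounded only on the
circle. There the quotient may be replaced by its limit, leaving a geometric sequence. -/
theorem cesaroTendsto_eval_div_pow_mul_pow {P : ℂ[X]} {D : ℕ} {z : ℂ} (hz : ‖z‖ ≤ 1)
    (hP : ‖z‖ = 1 → P.natDegree ≤ D) :
    CesaroTendsto (fun n => P.eval (n : ℂ) / (n : ℂ) ^ D * z ^ n)
      (if z = 1 then P.coeff D else 0) := by
  rcases hz.lt_or_eq with hlt | heq
  · rw [if_neg (by rintro rfl; simp at hlt)]
    exact cesaroTendsto_of_tendsto (tendsto_eval_div_pow_mul_pow P D hlt)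
  have ht := tendsto_eval_div_pow (hP heq)
  split_ifs with h1
  · simpa [h1] using cesaroTendsto_of_tendsto ht
  · have h0 : Tendsto (fun n : ℕ => (P.eval (n : ℂ) / (n : ℂ) ^ D - P.coeff D) * z ^ n) atTop
        (𝓝 0) := by
      refine tendsto_zero_iff_norm_tendsto_zero.2 ?_
      simpa [heq] using tendsto_zero_iff_norm_tendsto_zero.1 (tendsto_sub_nhds_zero_iff.2 ht)
    have hsum := (cesaroTendsto_of_tendsto h0).add ((cesaroTendsto_pow heq h1).const_mul (P.coeff D))
    simpa [sub_mul] using hsum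

/-- The Cesàro means of a generalized power sum, divided by `n ^ D * w ^ n` with `w` of maximal
modulus and `D` the maximal degree of the dominating coefficients, tend to the coefficient of
degree `D` at `w`. -/
theorem cesaroTendsto_powerSum_div {S : Finset ℂ} {P : ℂ → ℂ[X]} {D : ℕ} {w : ℂ} (hw : w ≠ 0)
    (hS : ∀ α ∈ S, P α ≠ 0 → ‖α‖ ≤ ‖w‖)
    (hD : ∀ α ∈ S, ‖α‖ = ‖w‖ → (P α).natDegree ≤ D) :
    CesaroTendsto (fun n => (∑ α ∈ S, (P α).eval (n : ℂ) * α ^ n) / ((n : ℂ) ^ D * w ^ n))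
      (if w ∈ S then (P w).coeff D else 0) := by
  have hterm (α : ℂ) (hα : α ∈ S) :
      CesaroTendsto (fun n => (P α).eval (n : ℂ) / (n : ℂ) ^ D * (α / w) ^ n)
        (if w = α then (P α).coeff D else 0) := by
    -- A root with zero coefficient may have modulus larger than `‖w‖`.
    by_cases hP : P α = 0
    · simpa [hP] using cesaroTendsto_zero
    have hw' : 0 < ‖w‖ := norm_pos_iff.2 hw
    have h := cesaroTendsto_eval_div_pow_mul_pow (P := P α) (D := D) (z := α / w)
      (by rw [norm_div]; exact div_le_one_of_le₀ (hS α hα hP) hw'.le)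
      (fun h => hD α hα (by rwa [norm_div, div_eq_one_iff_eq hw'.ne'] at h))
    simpa [div_eq_one_iff_eq hw, eq_comm] using h
  have hsum := CesaroTendsto.sum S hterm
  rw [Finset.sum_ite_eq] at hsum
  refine hsum.congr' (Eventually.of_forall fun n => ?_)
  rw [Finset.sum_div]
  refine Finset.sum_congr rfl fun α _ => ?_
  rw [div_pow, div_mul_div_comm]

/-- Among the summands of a nontrivial generalized power sum there is one of maximal modulus and,
subject to that, maximal degree. -/
theorem exists_leading_term {S : Finset ℂ} {P : ℂ → ℂ[X]} (hne : ∃ α ∈ S, P α ≠ 0) :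
    ∃ w ∈ S, P w ≠ 0 ∧ (∀ α ∈ S, P α ≠ 0 → ‖α‖ ≤ ‖w‖) ∧
      ∀ α ∈ S, ‖α‖ = ‖w‖ → (P α).natDegree ≤ (P w).natDegree := by
  classical
  obtain ⟨α₀, hα₀, hP₀⟩ := hne
  obtain ⟨β, hβ, hmax⟩ := (S.filter fun α => P α ≠ 0).exists_max_image (fun α => ‖α‖)
    ⟨α₀, Finset.mem_filter.2 ⟨hα₀, hP₀⟩⟩
  obtain ⟨w, hw, hdeg⟩ := ((S.filter fun α => P α ≠ 0).filter fun α => ‖α‖ = ‖β‖).exists_max_image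
    (fun α => (P α).natDegree) ⟨β, Finset.mem_filter.2 ⟨hβ, rfl⟩⟩
  simp only [Finset.mem_filter, and_imp] at hw hmax hdeg
  refine ⟨w, hw.1.1, hw.1.2, fun α hα hP => hw.2 ▸ hmax α hα hP, fun α hα hn => ?_⟩
  by_cases hP : P α = 0
  · simp [hP]
  · exact hdeg α hα hP (hn.trans hw.2)

/-- A generalized power sum that vanishes eventually is trivial. -/
theorem coeff_eq_zero_of_eventually_eq_zero {S : Finset ℂ} {P : ℂ → ℂ[X]} (h0 : (0 : ℂ) ∉ S)
    (h : ∀ᶠ n : ℕ in atTop, ∑ α ∈ S, (P α).eval (n : ℂ) * α ^ n = 0) :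
    ∀ α ∈ S, P α = 0 := by
  by_contra! hne
  obtain ⟨w, hwS, hPw, hmax, hdeg⟩ := exists_leading_term hne
  have hw : w ≠ 0 := by rintro rfl; exact h0 hwS
  have hlim := cesaroTendsto_powerSum_div hw hmax hdeg
  rw [if_pos hwS] at hlim
  refine hPw (leadingCoeff_eq_zero.1 (hlim.unique (cesaroTendsto_zero.congr' ?_)))
  filter_upwards [h] with n hn
  rw [hn, zero_div]

/-- A nontrivial generalized power sum with eventually nonnegative values has a positive
dominating root. -/
theorem exists_pos_dominating {S : Finset ℂ} {P : ℂ → ℂ[X]} (h0 : (0 : ℂ) ∉ S)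
    (hne : ∃ α ∈ S, P α ≠ 0) {r : ℕ → ℝ} (hr : ∀ᶠ n in atTop, 0 ≤ r n)
    (h : ∀ᶠ n : ℕ in atTop, (r n : ℂ) = ∑ α ∈ S, (P α).eval (n : ℂ) * α ^ n) :
    ∃ ρ : ℝ, 0 < ρ ∧ (ρ : ℂ) ∈ S ∧ P ρ ≠ 0 ∧ ∀ α ∈ S, P α ≠ 0 → ‖α‖ ≤ ρ := by
  obtain ⟨w, hwS, hPw, hmax, hdeg⟩ := exists_leading_term hne
  have hw : w ≠ 0 := by rintro rfl; exact h0 hwS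
  have hρ : 0 < ‖w‖ := norm_pos_iff.2 hw
  have hnorm : ‖((‖w‖ : ℝ) : ℂ)‖ = ‖w‖ := by simp
  refine ⟨‖w‖, hρ, ?_⟩
  by_contra hcon
  have hlim := cesaroTendsto_powerSum_div hw hmax hdeg
  rw [if_pos hwS] at hlim
  have hlim' := cesaroTendsto_powerSum_div (S := S) (P := P) (D := (P w).natDegree)
    (w := ((‖w‖ : ℝ) : ℂ)) (by exact_mod_cast hρ.ne') (by rwa [hnorm]) (by rwa [hnorm])
  have hzero : (if ((‖w‖ : ℝ) : ℂ) ∈ S then (P ((‖w‖ : ℝ) : ℂ)).coeff (P w).natDegree else 0) =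
      0 := by
    split_ifs with hS
    · by_cases hP : P ((‖w‖ : ℝ) : ℂ) = 0
      · simp [hP]
      · exact absurd ⟨hS, hP, hmax⟩ hcon
    · rfl
  rw [hzero] at hlim'
  -- Dividing by powers of `w` or of `‖w‖` gives equal absolute values; with `‖w‖` the quotient is
  -- eventually its own absolute value, as `r n ≥ 0`.
  refine hPw (leadingCoeff_eq_zero.1 (hlim.unique (CesaroTendsto.zero_of_norm_eq
    (u := fun n => (∑ α ∈ S, (P α).eval (n : ℂ) * α ^ n) /
      ((n : ℂ) ^ (P w).natDegree * ((‖w‖ : ℝ) : ℂ) ^ n)) (hlim'.congr' ?_) fun n => ?_)))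
  · filter_upwards [hr, h] with n hn hrn
    rw [← hrn]
    simp [abs_of_nonneg hn]
  · simp

/-! ### Sign changes -/

theorem zero_notMem_nonzeroRoots (E : LinearRecurrence ℝ) : (0 : ℂ) ∉ nonzeroRoots E := by
  simp [nonzeroRoots]

/-- The difference of two representations vanishes eventually, so the coefficients are unique and
any one representation decides membership. -/
theorem IsPowerSumRepr.mem_charRoots_iff {E : LinearRecurrence ℝ} {a : ℕ → ℝ} {P : ℂ → ℂ[X]}
    (hP : IsPowerSumRepr E a P) (α : ℂ) : α ∈ charRoots E a ↔ α ∈ nonzeroRoots E ∧ P α ≠ 0 := by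
  refine ⟨fun ⟨hα, Q, hQ, hQα⟩ => ⟨hα, ?_⟩, fun ⟨hα, hPα⟩ => ⟨hα, P, hP, hPα⟩⟩
  have hPQ := coeff_eq_zero_of_eventually_eq_zero (S := nonzeroRoots E)
    (P := fun β => P β - Q β) (zero_notMem_nonzeroRoots E) (by
      filter_upwards [hP, hQ] with n hn hn'
      simp only [eval_sub, sub_mul, Finset.sum_sub_distrib, ← hn, ← hn', sub_self]) α hα
  rwa [sub_eq_zero.1 hPQ]

theorem IsPowerSumRepr.neg {E : LinearRecurrence ℝ} {a : ℕ → ℝ} {P : ℂ → ℂ[X]}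
    (hP : IsPowerSumRepr E a P) : IsPowerSumRepr E (fun n => -a n) (fun α => -P α) := by
  filter_upwards [hP] with n hn
  simp [hn]

theorem charRoots_neg {E : LinearRecurrence ℝ} {a : ℕ → ℝ} (ha : E.IsSolution a) :
    charRoots E (fun n => -a n) = charRoots E a := by
  obtain ⟨P, hP⟩ := exists_isPowerSumRepr ha
  ext α
  rw [hP.mem_charRoots_iff, hP.neg.mem_charRoots_iff, neg_ne_zero]

theorem dominatingRoots_neg {E : LinearRecurrence ℝ} {a : ℕ → ℝ} (ha : E.IsSolution a) :
    dominatingRoots E (fun n => -a n) = dominatingRoots E a := by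
  rw [dominatingRoots, dominatingRoots, charRoots_neg ha]

/-- A solution of a linear recurrence that has no positive dominating characteristic root, and is
not eventually zero, is negative infinitely often. -/
theorem infinite_setOf_neg {E : LinearRecurrence ℝ} {a : ℕ → ℝ} (ha : E.IsSolution a)
    (hne : ∃ᶠ n : ℕ in atTop, a n ≠ 0)
    (hpos : ∀ α ∈ dominatingRoots E a, ¬ ∃ r : ℝ, 0 < r ∧ α = (r : ℂ)) :
    {n : ℕ | a n < 0}.Infinite := by
  rw [← Nat.frequently_atTop_iff_infinite]
  intro hev
  obtain ⟨P, hP⟩ := exists_isPowerSumRepr ha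
  have hP0 : ∃ α ∈ nonzeroRoots E, P α ≠ 0 := by
    by_contra! hzero
    refine hne ?_
    filter_upwards [hP] with n hn
    rw [Finset.sum_eq_zero fun α hα => by rw [hzero α hα, eval_zero, zero_mul]] at hn
    simpa using hn
  obtain ⟨ρ, hρ, hρS, hPρ, hmax⟩ := exists_pos_dominating (zero_notMem_nonzeroRoots E) hP0
    (hev.mono fun _ => not_lt.1) hP
  refine hpos ρ ⟨(hP.mem_charRoots_iff _).2 ⟨hρS, hPρ⟩, fun β hβ => ?_⟩ ⟨ρ, hρ, rfl⟩
  obtain ⟨hβS, hPβ⟩ := (hP.mem_charRoots_iff _).1 hβ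
  rw [Complex.norm_of_nonneg hρ.le]
  exact hmax β hβS hPβ

theorem isSolution_neg {E : LinearRecurrence ℝ} {a : ℕ → ℝ} (ha : E.IsSolution a) :
    E.IsSolution fun n => -a n :=
  E.solSpace.neg_mem ha

end RecurrenceSequence

theorem mainTheorem1 (E : LinearRecurrence ℝ) (a : ℕ → ℝ) (ha : E.IsSolution a)
    (hne : ∃ᶠ n : ℕ in Filter.atTop, a n ≠ 0)
    (hcard : (RecurrenceSequence.dominatingRoots E a).encard ≤ 4)
    (hpos : ∀ α ∈ RecurrenceSequence.dominatingRoots E a, ¬ ∃ r : ℝ, 0 < r ∧ α = (r : ℂ)) :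
    {n : ℕ | 0 < a n}.Infinite ∧ {n : ℕ | a n < 0}.Infinite := by
  refine ⟨?_, RecurrenceSequence.infinite_setOf_neg ha hne hpos⟩
  have h := RecurrenceSequence.infinite_setOf_neg (RecurrenceSequence.isSolution_neg ha)
    (by simpa using hne) (by rwa [RecurrenceSequence.dominatingRoots_neg ha])
  simpa using h
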